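/- Let $\mathrm{Prop}$ be a finite set of propositional variables, and let $\mathcal{L}=\mathcal{L}_{\Diamond,\wedge,\vee,\top,\bot}[\mathrm{Prop}]$ be the set of modal formulas generated from the variables in $\mathrm{Prop}$ by $\Diamond,\wedge,\vee,\top,\bot$, with the usual Kripke semantics. For a class $\mathcal{F}$ of frames, let $\mathbb{C}(\mathcal{F},\mathcal{L})$ be the concept class whose examples are the pointed Kripke models $(M,s)$ over $\mathrm{Prop}$ whose frame belongs to $\mathcal{F}$ and whose concepts are the formulas $\varphi\in\mathcal{L}$, where $\varphi$ stands for the set $\lambda(\varphi)$ of all examples $(M,s)$ with $M,s\models\varphi$. A finite characterisation of $\varphi\in\mathcal{L}$ with respect to $\mathbb{C}(\mathcal{F},\mathcal{L})$ is a pair $(E^+,E^-)$ of finite sets of examples such that $\varphi$ fits $(E^+,E^-)$, that is, $E^+\subseteq\lambda(\varphi)$ and $E^-\cap\lambda(\varphi)=\emptyset$, and such that every $\psi\in\mathcal{L}$ that fits $(E^+,E^-)$ satisfies $\lambda(\psi)=\lambda(\varphi)$. Let $\mathcal{F}$ be either the class of all finite frames or the class of all frames. Then every $\varphi\in\mathcal{L}$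 has a finite characterisation with respect to $\mathbb{C}(\mathcal{F},\mathcal{L})$. Moreover, such characterisations are effectively computable: there is an algorithm that, given a formula $\varphi\in\mathcal{L}$, outputs explicit descriptions of two finite lists of finite pointed models, the positive and the negative examples of a finite characterisation of $\varphi$ with respect to $\mathbb{C}(\mathcal{F},\mathcal{L})$. -/

import Mathlib

universe u v

namespace ModalChar

/-! ## Modal formulas and fragments -/

/-- The connectives of the full modal language; `neg` is negation of propositional variables. -/
inductive Connective : Type
  | top | bot | neg | conj | disj | dia | box

/-- The full modal language over the propositional variables `P`, in negation normal form. -/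
inductive Formula (P : Type v) : Type v
  | top : Formula P
  | bot : Formula P
  | var (p : P) : Formula P
  | neg (p : P) : Formula P
  | conj (φ ψ : Formula P) : Formula P
  | disj (φ ψ : Formula P) : Formula P
  | dia (φ : Formula P) : Formula P
  | box (φ : Formula P) : Formula P

/-- `φ.UsesOnly S`: every connective that occurs in `φ` belongs to `S`. -/
def Formula.UsesOnly {P : Type v} (S : Set Connective) : Formula P → Prop
  | .top => Connective.top ∈ S
  | .bot => Connective.bot ∈ S
  | .var _ => True
  | .neg _ => Connective.neg ∈ S
  | .conj φ ψ => Connective.conj ∈ S ∧ φ.UsesOnly S ∧ ψ.UsesOnly S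
  | .disj φ ψ => Connective.disj ∈ S ∧ φ.UsesOnly S ∧ ψ.UsesOnly S
  | .dia φ => Connective.dia ∈ S ∧ φ.UsesOnly S
  | .box φ => Connective.box ∈ S ∧ φ.UsesOnly S

/-- The fragment generated from the variables in `P` by the connectives in `S`. -/
def fragment (P : Type v) (S : Set Connective) : Set (Formula P) :=
  {φ | φ.UsesOnly S}

/-- The fragment generated by diamond, conjunction, disjunction, top and bottom. -/
def diaFragment (P : Type v) : Set (Formula P) :=
  fragment P {.dia, .conj, .disj, .top, .bot}

/-! ## Kripke semantics -/

/-- Kripke frames. -/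
structure Frame : Type (u + 1) where
  World : Type u
  Rel : World → World → Prop

/-- Pointed Kripke models; `val w` is the set of variables that are true at the world `w`. -/
structure PointedModel (P : Type v) : Type (max (u + 1) v) extends Frame.{u} where
  val : World → Set P
  point : World

/-- Truth of a formula at a world. -/
def Holds {P : Type v} (M : PointedModel.{u, v} P) : M.World → Formula P → Prop
  | _, .top => True
  | _, .bot => False
  | w, .var p => p ∈ M.val w
  | w, .neg p => p ∉ M.val w
  | w, .conj φ ψ => Holds M w φ ∧ Holds M w ψ
  | w, .disj φ ψ => Holds M w φ ∨ Holds M w ψ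
  | w, .dia φ => ∃ t, M.Rel w t ∧ Holds M t φ
  | w, .box φ => ∀ t, M.Rel w t → Holds M t φ

/-- Truth of a formula at the distinguished world. -/
def PointedModel.Sat {P : Type v} (M : PointedModel.{u, v} P) (φ : Formula P) : Prop :=
  Holds M M.point φ

/-- The class of all frames. -/
def allFrames : Set Frame.{u} := Set.univ

/-- The class of all finite frames. -/
def finFrames : Set Frame.{u} := {F | Finite F.World}

/-! ## Concept classes and finite characterisations -/

/-- A concept class: examples, concepts, and the set of positive examples of each concept. -/
structure ConceptClass where
  Example : Type u
  Concept : Type v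
  pos : Concept → Set Example

namespace ConceptClass

variable (C : ConceptClass.{u, v})

/-- `c` fits the labeled examples `(Ep, En)`: all of `Ep` are positive examples for `c`, all of `En`
are negative examples for `c`. -/
def Fits (c : C.Concept) (Ep En : Set C.Example) : Prop :=
  Ep ⊆ C.pos c ∧ En ⊆ (C.pos c)ᶜ

/-- `(Ep, En)` is a finite characterisation of `c`: finitely many labeled examples which, up to
equivalence, `c` and no other concept fits. -/
def IsFiniteCharacterisation (c : C.Concept) (Ep En : Set C.Example) : Prop :=
  Ep.Finite ∧ En.Finite ∧ C.Fits c Ep En ∧ ∀ c', C.Fits c' Ep En → C.pos c' = C.pos c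

/-- Every concept has a finite characterisation. -/
def AdmitsFiniteCharacterisations : Prop :=
  ∀ c, ∃ Ep En, C.IsFiniteCharacterisation c Ep En

end ConceptClass

/-- The concept class of a modal language `L` with respect to a class of frames `F`: the examples are
the pointed models based on a frame in `F`, the concepts are the formulas in `L`. -/
def modalClass {P : Type v} (F : Set Frame.{u}) (L : Set (Formula P)) : ConceptClass where
  Example := {M : PointedModel.{u, v} P // M.toFrame ∈ F}
  Concept := L
  pos := fun φ => {M | M.1.Sat φ.1}

/-! ## Effective computability -/

/-- A numbering of the seven connectives. -/
def Connective.equivFin : Connective ≃ Fin 7 where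
  toFun
    | .top => 0 | .bot => 1 | .neg => 2 | .conj => 3 | .disj => 4 | .dia => 5 | .box => 6
  invFun
    | 0 => .top | 1 => .bot | 2 => .neg | 3 => .conj | 4 => .disj | 5 => .dia | 6 => .box
  left_inv c := by cases c <;> rfl
  right_inv i := by fin_cases i <;> rfl

instance : Primcodable Connective := Primcodable.ofEquiv (Fin 7) Connective.equivFin

/-- The alphabet in which formulas are written down: the connectives and the variables. -/
abbrev Token (P : Type v) : Type v := Connective ⊕ P

/-- The string over this alphabet that represents a formula (prefix notation). -/
def Formula.toTokens {P : Type v} : Formula P → List (Token P)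
  | .top => [Sum.inl .top]
  | .bot => [Sum.inl .bot]
  | .var p => [Sum.inr p]
  | .neg p => [Sum.inl .neg, Sum.inr p]
  | .conj φ ψ => Sum.inl .conj :: (φ.toTokens ++ ψ.toTokens)
  | .disj φ ψ => Sum.inl .disj :: (φ.toTokens ++ ψ.toTokens)
  | .dia φ => Sum.inl .dia :: φ.toTokens
  | .box φ => Sum.inl .box :: φ.toTokens

/-- Explicit descriptions `(n, E, V)` of finite pointed models, by a number, a list of edges and a list
of pairs of a world and a variable that is true there. -/
abbrev ModelCode (P : Type v) : Type v := ℕ × List (ℕ × ℕ) × List (ℕ × P)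

/-- The finite pointed model that `(n, E, V)` describes. Its worlds are `0, …, n`, the distinguished
world is `0`, there is an edge from `i` to `j` iff `(i, j)` is in the list `E`, and `p` is true at `i`
iff `(i, p)` is in the list `V`. Every finite pointed model over a finite set of variables is isomorphic
to one of this form. -/
def ModelCode.toModel {P : Type v} (c : ModelCode P) : PointedModel.{u, v} P where
  World := ULift.{u} (Fin (c.1 + 1))
  Rel i j := ((i.down : ℕ), (j.down : ℕ)) ∈ c.2.1
  val i := {p | ((i.down : ℕ), p) ∈ c.2.2}
  point := ⟨0⟩

/-- The examples (pointed models based on a frame in `F`) that are described by a list of codes. -/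
def codedExamples {P : Type v} (F : Set Frame.{u}) (L : Set (Formula P)) (l : List (ModelCode P)) :
    Set (modalClass F L).Example :=
  {M | ∃ c ∈ l, M.1 = ModelCode.toModel c}

/-- The formulas in `L` have effectively computable finite characterisations with respect to the frame
class `F`: some algorithm, given (the string that represents) a formula `φ` in `L`, outputs explicit
descriptions of finitely many positive and negative examples, all based on frames in `F`, which are a
finite characterisation of `φ`. -/
def HasComputableCharacterisations {P : Type v} [Primcodable P] (F : Set Frame.{u})
    (L : Set (Formula P)) : Prop :=
  ∃ f : List (Token P) → List (ModelCode P) × List (ModelCode P), Computable f ∧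
    ∀ φ : L,
      (∀ c ∈ (f φ.1.toTokens).1 ++ (f φ.1.toTokens).2,
        (ModelCode.toModel c : PointedModel.{u, v} P).toFrame ∈ F) ∧
      (modalClass F L).IsFiniteCharacterisation φ
        (codedExamples F L (f φ.1.toTokens).1) (codedExamples F L (f φ.1.toTokens).2)

end ModalChar

open ModalChar

/-! Formulas of the fragment are positive and existential, so homomorphisms preserve their truth
(`holds_of_hom`). Let the string of `φ` have length `m`. If `M` satisfies `φ`, then the point and at
most `m` further worlds witness this, and the model pulled back along an enumeration of them
satisfies `φ` and maps homomorphically to `M` (`exists_small_positive`). If `M` refutes `φ`,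
identifying worlds that agree on the subformulas of `φ` leaves at most `2 ^ m` classes; the quotient
still refutes `φ` and receives a homomorphism from `M` (`exists_small_negative`).

Hence all models with worlds `0, …, 2 ^ m`, labelled by the truth of `φ`, characterise it: a fitting
`ψ` is true in every model of `φ`, because a positive example maps to that model, and false in every
countermodel of `φ`, because that countermodel maps to a negative example.

Listing these models and checking `φ` in them is primitive recursive; the check runs a stack
evaluation of the prefix string. -/

namespace ModalChar

/-! ## Preservation of diamond formulas along homomorphisms -/

section Semantics

variable {P : Type v}

theorem holds_of_hom {M N : PointedModel.{u, v} P} (f : M.World → N.World)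
    (hrel : ∀ i j, M.Rel i j → N.Rel (f i) (f j)) (hval : ∀ i, M.val i ⊆ N.val (f i))
    {φ : Formula P} (hφ : φ ∈ diaFragment P) {w : M.World} (h : Holds M w φ) :
    Holds N (f w) φ := by
  induction φ generalizing w with
  | top => trivial
  | bot => exact h
  | var p => exact hval _ h
  | neg p => simp [diaFragment, fragment, Formula.UsesOnly] at hφ
  | conj φ ψ ih₁ ih₂ => exact ⟨ih₁ hφ.2.1 h.1, ih₂ hφ.2.2 h.2⟩
  | disj φ ψ ih₁ ih₂ => exact h.imp (ih₁ hφ.2.1) (ih₂ hφ.2.2)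
  | dia φ ih =>
    obtain ⟨t, ht, h⟩ := h
    exact ⟨f t, hrel _ _ ht, ih hφ.2 h⟩
  | box φ ih => simp [diaFragment, fragment, Formula.UsesOnly] at hφ

/-- A true diamond formula has few witnesses: it stays true in every model that is pulled back along
a map whose range contains them. -/
theorem exists_witnesses (M : PointedModel.{u, v} P) {φ : Formula P} (hφ : φ ∈ diaFragment P)
    {w : M.World} (h : Holds M w φ) :
    ∃ l : List M.World, l.length ≤ φ.toTokens.length ∧
      ∀ (T : PointedModel.{u, v} P) (g : T.World → M.World),
        (∀ i j, T.Rel i j ↔ M.Rel (g i) (g j)) → (∀ i, T.val i = M.val (g i)) →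
        (∀ x ∈ l, ∃ i, g i = x) → ∀ i, g i = w → Holds T i φ := by
  induction φ generalizing w with
  | top => exact ⟨[], by simp, fun _ _ _ _ _ _ _ => trivial⟩
  | bot => exact h.elim
  | var p =>
    refine ⟨[], by simp, fun T g _ hv _ i hi => ?_⟩
    change p ∈ T.val i
    rw [hv, hi]
    exact h
  | neg p => simp [diaFragment, fragment, Formula.UsesOnly] at hφ
  | conj φ ψ ih₁ ih₂ =>
    obtain ⟨l₁, hl₁, h₁⟩ := ih₁ hφ.2.1 h.1
    obtain ⟨l₂, hl₂, h₂⟩ := ih₂ hφ.2.2 h.2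
    refine ⟨l₁ ++ l₂, by simp only [Formula.toTokens, List.length_append, List.length_cons]; omega,
      fun T g hr hv hl i hi => ⟨?_, ?_⟩⟩
    · exact h₁ T g hr hv (fun x hx => hl x (List.mem_append_left _ hx)) i hi
    · exact h₂ T g hr hv (fun x hx => hl x (List.mem_append_right _ hx)) i hi
  | disj φ ψ ih₁ ih₂ =>
    rcases h with h | h
    · obtain ⟨l, hl, h'⟩ := ih₁ hφ.2.1 h
      exact ⟨l, by simp only [Formula.toTokens, List.length_append, List.length_cons]; omega,
        fun T g hr hv hx i hi => Or.inl (h' T g hr hv hx i hi)⟩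
    · obtain ⟨l, hl, h'⟩ := ih₂ hφ.2.2 h
      exact ⟨l, by simp only [Formula.toTokens, List.length_append, List.length_cons]; omega,
        fun T g hr hv hx i hi => Or.inr (h' T g hr hv hx i hi)⟩
  | dia φ ih =>
    obtain ⟨t, ht, h⟩ := h
    obtain ⟨l, hl, h'⟩ := ih hφ.2 h
    refine ⟨t :: l, by simpa [Formula.toTokens] using hl, fun T g hr hv hx i hi => ?_⟩
    -- `g` need not be injective: any preimage `j` of `t` is a successor of `i`, because edges are
    -- pulled back in full.
    obtain ⟨j, hj⟩ := hx t (List.mem_cons_self ..)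
    exact ⟨j, (hr i j).2 (by rwa [hi, hj]),
      h' T g hr hv (fun x hx' => hx x (List.mem_cons_of_mem _ hx')) j hj⟩
  | box φ ih => simp [diaFragment, fragment, Formula.UsesOnly] at hφ

/-- The subformulas of a formula, with repetitions. -/
def Formula.subs : Formula P → List (Formula P)
  | .top => [.top]
  | .bot => [.bot]
  | .var p => [.var p]
  | .neg p => [.neg p]
  | .conj φ ψ => .conj φ ψ :: (φ.subs ++ ψ.subs)
  | .disj φ ψ => .disj φ ψ :: (φ.subs ++ ψ.subs)
  | .dia φ => .dia φ :: φ.subs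
  | .box φ => .box φ :: φ.subs

theorem Formula.self_mem_subs (φ : Formula P) : φ ∈ φ.subs := by
  cases φ <;> simp [subs]

theorem Formula.length_subs_le (φ : Formula P) : φ.subs.length ≤ φ.toTokens.length := by
  induction φ <;> simp only [subs, toTokens, List.length_cons, List.length_append,
    List.length_nil] <;> omega

/-- Truth in a quotient that respects truth of the subformulas reflects truth in the original
model. -/
theorem holds_of_holds_quotient {M T : PointedModel.{u, v} P} (h : M.World → T.World)
    (hrel : ∀ i j, T.Rel i j → ∃ w t, h w = i ∧ h t = j ∧ M.Rel w t)
    (hval : ∀ i p, p ∈ T.val i → ∃ w, h w = i ∧ p ∈ M.val w)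
    {χ : Formula P} (hχ : χ ∈ diaFragment P)
    (hagree : ∀ w t, h w = h t → ∀ θ ∈ χ.subs, Holds M w θ → Holds M t θ)
    {w : M.World} (hw : Holds T (h w) χ) : Holds M w χ := by
  induction χ generalizing w with
  | top => trivial
  | bot => exact hw
  | var p =>
    obtain ⟨t, ht, hp⟩ := hval _ _ hw
    exact hagree t w ht _ (Formula.self_mem_subs _) hp
  | neg p => simp [diaFragment, fragment, Formula.UsesOnly] at hχ
  | conj φ ψ ih₁ ih₂ =>
    exact ⟨ih₁ hχ.2.1 (fun w t e θ hθ => hagree w t e θ (by simp [Formula.subs, hθ])) hw.1,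
      ih₂ hχ.2.2 (fun w t e θ hθ => hagree w t e θ (by simp [Formula.subs, hθ])) hw.2⟩
  | disj φ ψ ih₁ ih₂ =>
    exact hw.imp (ih₁ hχ.2.1 (fun w t e θ hθ => hagree w t e θ (by simp [Formula.subs, hθ])))
      (ih₂ hχ.2.2 (fun w t e θ hθ => hagree w t e θ (by simp [Formula.subs, hθ])))
  | dia φ ih =>
    obtain ⟨j, hj, hφ⟩ := hw
    obtain ⟨w', t, hw', rfl, hr⟩ := hrel _ _ hj
    -- The edge lifts to a world `w'` in the fibre of `w`, not to `w` itself; agreement on the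
    -- diamond formula moves its truth from `w'` to `w`.
    exact hagree w' w hw' _ (Formula.self_mem_subs _)
      ⟨t, hr, ih hχ.2 (fun w t e θ hθ => hagree w t e θ (by simp [Formula.subs, hθ])) hφ⟩
  | box φ ih => simp [diaFragment, fragment, Formula.UsesOnly] at hχ

end Semantics

/-- The number whose binary digits are the values of `b` on a list. -/
def bitCode {α : Type*} (b : α → Bool) : List α → ℕ
  | [] => 0
  | a :: l => Nat.bit (b a) (bitCode b l)

theorem bitCode_lt {α : Type*} (b : α → Bool) (l : List α) : bitCode b l < 2 ^ l.length := by
  induction l with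
  | nil => simp [bitCode]
  | cons a l ih =>
    rw [bitCode, Nat.bit_val, List.length_cons, pow_succ]
    have := Bool.toNat_le (b a)
    omega

/-- Used to give the point the number `0`, the distinguished world of every coded model. -/
theorem bitCode_eq_zero {α : Type*} {b : α → Bool} {l : List α} (h : ∀ a ∈ l, b a = false) :
    bitCode b l = 0 := by
  induction l with
  | nil => rfl
  | cons a l ih =>
    rw [bitCode, h a (List.mem_cons_self ..), ih fun x hx => h x (List.mem_cons_of_mem _ hx)]
    rfl

theorem eq_of_bitCode_eq {α : Type*} {b c : α → Bool} {l : List α}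
    (h : bitCode b l = bitCode c l) : ∀ a ∈ l, b a = c a := by
  induction l with
  | nil => simp
  | cons a l ih =>
    simp only [bitCode, Nat.bit_val] at h
    have h₁ : b a = c a := by
      cases hb : b a <;> cases hc : c a <;>
        simp only [hb, hc, Bool.toNat_true, Bool.toNat_false] at h <;> first | rfl | omega
    have h₂ : bitCode b l = bitCode c l := by
      rw [h₁] at h
      omega
    intro x hx
    rcases List.mem_cons.1 hx with rfl | hx
    · exact h₁
    · exact ih h₂ x hx

/-! ## Enumeration of the models with a given number of worlds -/

section Enumeration

variable {α β : Type*}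

/-- All sublists of a list. -/
def sublistsOf (l : List α) : List (List α) :=
  l.foldr (fun a s => s ++ s.map (List.cons a)) [[]]

theorem filter_mem_sublistsOf (q : α → Bool) (l : List α) : l.filter q ∈ sublistsOf l := by
  induction l with
  | nil => simp [sublistsOf]
  | cons a l ih =>
    have e : sublistsOf (a :: l) = sublistsOf l ++ (sublistsOf l).map (List.cons a) := rfl
    rw [e, List.mem_append, List.filter_cons]
    split
    · exact Or.inr (List.mem_map_of_mem ih)
    · exact Or.inl ih

theorem subset_of_mem_sublistsOf {l m : List α} (h : m ∈ sublistsOf l) : m ⊆ l := by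
  induction l generalizing m with
  | nil => simp_all [sublistsOf]
  | cons a l ih =>
    have e : sublistsOf (a :: l) = sublistsOf l ++ (sublistsOf l).map (List.cons a) := rfl
    rw [e, List.mem_append, List.mem_map] at h
    rcases h with h | ⟨m, h, rfl⟩
    · exact List.subset_cons_of_subset _ (ih h)
    · exact List.cons_subset_cons _ (ih h)

/-- The list of all pairs from two lists. -/
def pairsOf (l : List α) (m : List β) : List (α × β) :=
  l.flatMap fun a => m.map (Prod.mk a)

theorem mem_pairsOf {l : List α} {m : List β} {x : α × β} :
    x ∈ pairsOf l m ↔ x.1 ∈ l ∧ x.2 ∈ m := by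
  rcases x with ⟨a, b⟩
  simp [pairsOf]

/-- Codes of all models with worlds `0, …, n` over the variables in a list. -/
def modelCodes {P : Type v} (ps : List P) (n : ℕ) : List (ModelCode P) :=
  (sublistsOf (pairsOf (List.range (n + 1)) (List.range (n + 1)))).flatMap fun E =>
    (sublistsOf (pairsOf (List.range (n + 1)) ps)).map fun V => (n, E, V)

theorem mem_modelCodes {P : Type v} {ps : List P} {n : ℕ} {c : ModelCode P} :
    c ∈ modelCodes ps n ↔ c.1 = n ∧
      c.2.1 ∈ sublistsOf (pairsOf (List.range (n + 1)) (List.range (n + 1))) ∧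
      c.2.2 ∈ sublistsOf (pairsOf (List.range (n + 1)) ps) := by
  rcases c with ⟨m, E, V⟩
  simp only [modelCodes, List.mem_flatMap, List.mem_map, Prod.mk.injEq]
  constructor
  · rintro ⟨E', hE, V', hV, rfl, rfl, rfl⟩
    exact ⟨rfl, hE, hV⟩
  · rintro ⟨rfl, hE, hV⟩
    exact ⟨E, hE, V, hV, rfl, rfl, rfl⟩

/-- Model checking computes with bare numbers; this bound excludes diamond witnesses that are not
worlds. -/
theorem edge_lt_of_mem_modelCodes {P : Type v} {ps : List P} {n : ℕ} {c : ModelCode P}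
    (hc : c ∈ modelCodes ps n) : ∀ e ∈ c.2.1, e.2 < c.1 + 1 := by
  obtain ⟨rfl, hE, -⟩ := mem_modelCodes.1 hc
  intro e he
  simpa using (mem_pairsOf.1 (subset_of_mem_sublistsOf hE he)).2

open Classical in
-- `R` and `V` may be undecidable: only the existence of a code in the list matters, since the
-- algorithm outputs the entire list.
theorem exists_modelCode {P : Type v} {ps : List P} (hps : ∀ p, p ∈ ps) (n : ℕ)
    (R : ℕ → ℕ → Prop) (V : ℕ → Set P) :
    ∃ c ∈ modelCodes ps n, c.1 = n ∧ (∀ i j, (i, j) ∈ c.2.1 ↔ i ≤ n ∧ j ≤ n ∧ R i j) ∧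
      ∀ i p, (i, p) ∈ c.2.2 ↔ i ≤ n ∧ p ∈ V i := by
  refine ⟨(n, (pairsOf (List.range (n + 1)) (List.range (n + 1))).filter fun e => R e.1 e.2,
    (pairsOf (List.range (n + 1)) ps).filter fun e => e.2 ∈ V e.1), ?_, rfl, ?_, ?_⟩
  · exact mem_modelCodes.2 ⟨rfl, filter_mem_sublistsOf _ _, filter_mem_sublistsOf _ _⟩
  · intro i j
    simp [mem_pairsOf, and_assoc]
  · intro i p
    simp [mem_pairsOf, hps]

end Enumeration

/-! ## Small models -/

section SmallModels

variable {P : Type v} {ps : List P}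

theorem exists_small_positive (hps : ∀ p, p ∈ ps) {M : PointedModel.{u, v} P} {φ : Formula P}
    (hφ : φ ∈ diaFragment P) (h : M.Sat φ) {n : ℕ} (hn : φ.toTokens.length ≤ n) :
    ∃ c ∈ modelCodes ps n, (ModelCode.toModel.{u} c).Sat φ ∧
      ∀ ψ ∈ diaFragment P, (ModelCode.toModel.{u} c).Sat ψ → M.Sat ψ := by
  obtain ⟨l, hl, hw⟩ := exists_witnesses M hφ h
  -- World `0` is the point and the next worlds are the witnesses; by the default value, surplus
  -- worlds become copies of the point, so any `n` that is large enough works.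
  let f : ℕ → M.World := fun i => (M.point :: l).getD i M.point
  obtain ⟨c, hc, hcn, hE, hV⟩ := exists_modelCode hps n (fun i j => M.Rel (f i) (f j))
    fun i => M.val (f i)
  let g : (ModelCode.toModel.{u} c).World → M.World := fun i => f (i.down : ℕ)
  have hle (i : (ModelCode.toModel.{u} c).World) : (i.down : ℕ) ≤ n :=
    hcn ▸ Nat.lt_succ_iff.1 i.down.2
  have hrel (i j) : (ModelCode.toModel.{u} c).Rel i j ↔ M.Rel (g i) (g j) :=
    (hE _ _).trans (by simp [hle, g])
  have hval (i) : (ModelCode.toModel.{u} c).val i = M.val (g i) :=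
    Set.ext fun p => (hV _ _).trans (by simp [hle, g])
  refine ⟨c, hc, hw _ g hrel hval (fun x hx => ?_) _ rfl, fun ψ hψ hs =>
    holds_of_hom g (fun i j => (hrel i j).1) (fun i => (hval i).subset) hψ hs⟩
  obtain ⟨k, hk, rfl⟩ := List.getElem_of_mem hx
  refine ⟨⟨⟨k + 1, by omega⟩⟩, ?_⟩
  simp [g, f, hk]

open Classical in
theorem exists_small_negative (hps : ∀ p, p ∈ ps) {M : PointedModel.{u, v} P} {φ : Formula P}
    (hφ : φ ∈ diaFragment P) (h : ¬ M.Sat φ) {n : ℕ} (hn : 2 ^ φ.toTokens.length ≤ n) :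
    ∃ c ∈ modelCodes ps n, ¬ (ModelCode.toModel.{u} c).Sat φ ∧
      ∀ ψ ∈ diaFragment P, M.Sat ψ → (ModelCode.toModel.{u} c).Sat ψ := by
  -- Bits record disagreement with the point, rather than truth, so that the point itself receives
  -- code `0`.
  let b : M.World → Formula P → Bool := fun w χ => decide ¬(Holds M w χ ↔ Holds M M.point χ)
  let k : M.World → ℕ := fun w => bitCode (b w) φ.subs
  have hk (w) : k w ≤ n := ((bitCode_lt _ _).le.trans
    (Nat.pow_le_pow_right (by norm_num) φ.length_subs_le)).trans hn
  have hk0 : k M.point = 0 := bitCode_eq_zero (by simp [b])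
  -- The least edges and valuation that make `k` a homomorphism; numbers that are not codes of
  -- worlds become isolated worlds without true variables.
  obtain ⟨c, hc, hcn, hE, hV⟩ := exists_modelCode hps n
    (fun i j => ∃ w t, k w = i ∧ k t = j ∧ M.Rel w t) fun i => {p | ∃ w, k w = i ∧ p ∈ M.val w}
  let g : M.World → (ModelCode.toModel.{u} c).World := fun w =>
    ⟨⟨k w, hcn ▸ Nat.lt_succ_iff.2 (hk w)⟩⟩
  have hg (w) (i) : g w = i ↔ k w = (i.down : ℕ) :=
    ULift.ext_iff.trans Fin.ext_iff
  have hg0 : g M.point = (ModelCode.toModel.{u} c).point := (hg _ _).2 hk0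
  refine ⟨c, hc, fun hs => h ?_, fun ψ hψ hs => ?_⟩
  · refine holds_of_holds_quotient g (fun i j hij => ?_) (fun i p hp => ?_) hφ
      (fun w t e θ hθ hw => ?_) (hg0 ▸ hs : Holds _ (g M.point) φ)
    · obtain ⟨-, -, w, t, h₁, h₂, h₃⟩ := (hE _ _).1 hij
      exact ⟨w, t, (hg _ _).2 h₁, (hg _ _).2 h₂, h₃⟩
    · obtain ⟨-, w, h₁, h₂⟩ := (hV _ _).1 hp
      exact ⟨w, (hg _ _).2 h₁, h₂⟩
    · have := eq_of_bitCode_eq (b := b w) (c := b t) ((hg w _).1 e) θ hθ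
      simp only [b, decide_eq_decide] at this
      tauto
  · have := holds_of_hom (N := ModelCode.toModel.{u} c) g
      (fun w t ht => (hE _ _).2 ⟨hk w, hk t, w, t, rfl, rfl, ht⟩)
      (fun w p hp => (hV _ _).2 ⟨hk w, w, rfl, hp⟩) hψ hs
    rwa [hg0] at this

end SmallModels

/-! ## Model checking on strings -/

section ModelChecking

variable {P : Type v}

open Classical in
/-- The effect of a connective on a stack of truth sets. -/
noncomputable def evalConnective (c : ModelCode P) (s : List (List ℕ)) (k : Connective) :
    List (List ℕ) :=
  if k = .top then List.range (c.1 + 1) :: s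
  else if k = .bot then [] :: s
  else if k = .conj then (s.headI.filter fun i => i ∈ s.tail.headI) :: s.tail.tail
  else if k = .disj then (s.headI ++ s.tail.headI) :: s.tail.tail
  -- The remaining case is meant for `dia`; `neg` and `box` also land here, but do not occur in the
  -- fragment.
  else ((c.2.1.filter fun e => e.2 ∈ s.headI).map Prod.fst) :: s.tail

open Classical in
/-- One step of the evaluation of a string in prefix notation from right to left, where the stack
contains truth sets of formulas. -/
noncomputable def evalStep (c : ModelCode P) (t : Token P) (s : List (List ℕ)) : List (List ℕ) :=
  Sum.casesOn t (evalConnective c s) fun p => ((c.2.2.filter fun e => e.2 = p).map Prod.fst) :: s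

/-- The stack of truth sets of the formulas in a string in prefix notation. -/
noncomputable def evalTokens (c : ModelCode P) (l : List (Token P)) (s : List (List ℕ)) :
    List (List ℕ) :=
  l.foldr (evalStep c) s

/-- The arbitrary stack `s` carries the induction: in a binary formula the right argument is
evaluated first, and its truth set lies on the stack while the left one is evaluated. -/
theorem evalTokens_toTokens {c : ModelCode P} (hc : ∀ e ∈ c.2.1, e.2 < c.1 + 1) {φ : Formula P}
    (hφ : φ ∈ diaFragment P) (s : List (List ℕ)) :
    ∃ l, evalTokens c φ.toTokens s = l :: s ∧
      ∀ i : (ModelCode.toModel.{u} c).World,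
        (i.down : ℕ) ∈ l ↔ Holds (ModelCode.toModel.{u} c) i φ := by
  induction φ generalizing s with
  | top => exact ⟨_, by simp [evalTokens, Formula.toTokens, evalStep, evalConnective]; rfl,
      fun i => by simpa [Holds] using i.down.2⟩
  | bot => exact ⟨_, by simp [evalTokens, Formula.toTokens, evalStep, evalConnective]; rfl,
      fun i => by simp [Holds]⟩
  | var p => exact ⟨_, by simp [evalTokens, Formula.toTokens, evalStep]; rfl,
      fun i => by simp [Holds, ModelCode.toModel]⟩
  | neg p => simp [diaFragment, fragment, Formula.UsesOnly] at hφ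
  | conj φ ψ ih₁ ih₂ =>
    obtain ⟨l₂, e₂, h₂⟩ := ih₂ hφ.2.2 s
    obtain ⟨l₁, e₁, h₁⟩ := ih₁ hφ.2.1 (l₂ :: s)
    simp only [evalTokens] at e₁ e₂
    exact ⟨_, by simp [evalTokens, Formula.toTokens, evalStep, evalConnective, e₁, e₂]; rfl,
      fun i => by simp [Holds, h₁, h₂]⟩
  | disj φ ψ ih₁ ih₂ =>
    obtain ⟨l₂, e₂, h₂⟩ := ih₂ hφ.2.2 s
    obtain ⟨l₁, e₁, h₁⟩ := ih₁ hφ.2.1 (l₂ :: s)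
    simp only [evalTokens] at e₁ e₂
    exact ⟨_, by simp [evalTokens, Formula.toTokens, evalStep, evalConnective, e₁, e₂]; rfl,
      fun i => by simp [Holds, h₁, h₂]⟩
  | dia φ ih =>
    obtain ⟨l, e, h⟩ := ih hφ.2 s
    simp only [evalTokens] at e
    refine ⟨_, by simp [evalTokens, Formula.toTokens, evalStep, evalConnective, e]; rfl, fun i => ?_⟩
    simp only [List.mem_map, List.mem_filter, decide_eq_true_eq, Prod.exists, exists_and_right,
      exists_eq_right, Holds]
    constructor
    · rintro ⟨j, hj, hl⟩
      exact ⟨⟨⟨j, hc _ hj⟩⟩, hj, (h ⟨⟨j, hc _ hj⟩⟩).1 hl⟩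
    · rintro ⟨j, hj, hl⟩
      exact ⟨_, hj, (h j).2 hl⟩
  | box φ ih => simp [diaFragment, fragment, Formula.UsesOnly] at hφ

/-- Truth of the formula that a string represents in the model that a code describes. -/
def Accepts (l : List (Token P)) (c : ModelCode P) : Prop :=
  0 ∈ (evalTokens c l []).headI

theorem accepts_toTokens {c : ModelCode P} (hc : ∀ e ∈ c.2.1, e.2 < c.1 + 1) {φ : Formula P}
    (hφ : φ ∈ diaFragment P) :
    Accepts φ.toTokens c ↔ (ModelCode.toModel.{u} c).Sat φ := by
  obtain ⟨l, e, h⟩ := evalTokens_toTokens.{u} hc hφ []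
  rw [Accepts, e]
  exact h ⟨0⟩

open Classical in
/-- The models of a size that is exponential in a formula, divided into those in which it is true and
those in which it is false. -/
noncomputable def characterisation (ps : List P) (l : List (Token P)) :
    List (ModelCode P) × List (ModelCode P) :=
  ((modelCodes ps (2 ^ l.length)).filter fun c => Accepts l c,
    (modelCodes ps (2 ^ l.length)).filter fun c => ¬ Accepts l c)

theorem codedExamples_finite (F : Set Frame.{u}) (L : Set (Formula P)) (l : List (ModelCode P)) :
    (codedExamples F L l).Finite := by
  refine Set.Finite.of_finite_image (f := Subtype.val) ?_ Subtype.val_injective.injOn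
  refine (l.finite_toSet.image ModelCode.toModel.{u}).subset ?_
  rintro _ ⟨M, ⟨c, hc, e⟩, rfl⟩
  exact ⟨c, hc, e.symm⟩

theorem isFiniteCharacterisation_characterisation {ps : List P} (hps : ∀ p, p ∈ ps)
    {F : Set Frame.{u}} (hF : finFrames ⊆ F) (φ : diaFragment P) :
    (modalClass F (diaFragment P)).IsFiniteCharacterisation φ
      (codedExamples F _ (characterisation ps φ.1.toTokens).1)
      (codedExamples F _ (characterisation ps φ.1.toTokens).2) := by
  have hmem (c : ModelCode P) : (ModelCode.toModel.{u} c).toFrame ∈ F :=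
    hF (inferInstanceAs (Finite (ULift.{u} (Fin (c.1 + 1)))))
  have hacc {c : ModelCode P} (hc : c ∈ modelCodes ps (2 ^ φ.1.toTokens.length)) :=
    accepts_toTokens.{u} (edge_lt_of_mem_modelCodes hc) φ.2
  refine ⟨codedExamples_finite _ _ _, codedExamples_finite _ _ _, ⟨?_, ?_⟩, ?_⟩
  · rintro ⟨_, _⟩ ⟨c, hc, rfl⟩
    simp only [characterisation, List.mem_filter, decide_eq_true_eq] at hc
    exact (hacc hc.1).1 hc.2
  · rintro ⟨_, _⟩ ⟨c, hc, rfl⟩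
    simp only [characterisation, List.mem_filter, decide_eq_true_eq] at hc
    exact fun h => hc.2 ((hacc hc.1).2 h)
  · rintro ψ ⟨hp, hn⟩
    ext M
    constructor
    · intro h
      by_contra hM
      obtain ⟨c, hc, hs, ht⟩ := exists_small_negative hps φ.2 hM le_rfl
      refine hn (a := ⟨ModelCode.toModel c, hmem c⟩) ⟨c, ?_, rfl⟩ (ht ψ.1 ψ.2 h)
      simpa [characterisation, hc, hacc hc] using hs
    · intro h
      -- Positive examples need only linear size, but padding lets them share the size `2 ^ m` of
      -- the negative ones.
      obtain ⟨c, hc, hs, ht⟩ := exists_small_positive hps φ.2 h Nat.lt_two_pow_self.le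
      refine ht ψ.1 ψ.2 (hp (a := ⟨ModelCode.toModel c, hmem c⟩) ⟨c, ?_, rfl⟩)
      simpa [characterisation, hc, hacc hc] using hs

end ModelChecking

/-! ## Computability -/

section Computability

open Primrec

theorem primrecRel_mem {α : Type*} [Primcodable α] : PrimrecRel fun (a : α) (l : List α) => a ∈ l :=
  (PrimrecRel.exists_mem_list (Primrec.eq (α := α))).swap.of_eq fun a l => by
    simp [Function.swap]

theorem primrec_filter {α β : Type*} [Primcodable α] [Primcodable β] {f : α → List β}
    {p : α → β → Prop} [DecidableRel p] (hf : Primrec f) (hp : PrimrecRel p) :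
    Primrec fun a => (f a).filter fun b => p a b :=
  ((PrimrecRel.listFilter (R := Function.swap p) hp.swap).comp hf Primrec.id).of_eq fun _ => rfl

theorem primrec_sublistsOf {α : Type*} [Primcodable α] : Primrec (sublistsOf (α := α)) :=
  list_foldr .id (const [[]]) <| to₂ <| list_append.comp (snd.comp snd) <|
    list_map (snd.comp snd) (list_cons.comp (fst.comp (snd.comp fst)) snd).to₂

theorem primrec_pairsOf {α β : Type*} [Primcodable α] [Primcodable β] :
    Primrec₂ (pairsOf (α := α) (β := β)) :=
  to₂ <| list_flatMap fst <| to₂ <| list_map (snd.comp fst) (pair (snd.comp fst) snd).to₂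

variable {P : Type v} [Primcodable P]

theorem primrec_modelCodes (ps : List P) : Primrec (modelCodes ps) := by
  have hr : Primrec fun n => List.range (n + 1) := list_range.comp succ
  refine list_flatMap (primrec_sublistsOf.comp (primrec_pairsOf.comp hr hr)) ?_
  exact list_map (primrec_sublistsOf.comp (primrec_pairsOf.comp (hr.comp fst) (const ps)))
    (pair (fst.comp fst) (pair (snd.comp fst) snd)).to₂

theorem primrec_evalConnective : Primrec fun x : (ModelCode P × List (List ℕ)) × Connective =>
    evalConnective x.1.1 x.1.2 x.2 := by
  classical
  have hs : Primrec fun x : (ModelCode P × List (List ℕ)) × Connective => x.1.2 := snd.comp fst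
  have hk (k : Connective) :
      PrimrecPred fun x : (ModelCode P × List (List ℕ)) × Connective => x.2 = k :=
    Primrec.eq.comp snd (const k)
  have h₁ := list_headI.comp hs
  have h₂ := list_headI.comp (list_tail.comp hs)
  have ht := list_tail.comp (list_tail.comp hs)
  have hrange : Primrec fun x : (ModelCode P × List (List ℕ)) × Connective =>
      List.range (x.1.1.1 + 1) := list_range.comp (succ.comp (fst.comp (fst.comp fst)))
  have hedges : Primrec fun x : (ModelCode P × List (List ℕ)) × Connective => x.1.1.2.1 :=
    fst.comp (snd.comp (fst.comp fst))
  have hmem : PrimrecRel fun (x : (ModelCode P × List (List ℕ)) × Connective) (i : ℕ) =>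
      i ∈ x.1.2.tail.headI := primrecRel_mem.comp snd (h₂.comp fst)
  have hmem' : PrimrecRel fun (x : (ModelCode P × List (List ℕ)) × Connective) (e : ℕ × ℕ) =>
      e.2 ∈ x.1.2.headI := primrecRel_mem.comp (snd.comp snd) (h₁.comp fst)
  have hconj := primrec_filter h₁ hmem
  have hdia := primrec_filter hedges hmem'
  exact (ite (hk .top) (list_cons.comp hrange hs) <|
    ite (hk .bot) (list_cons.comp (const []) hs) <|
    ite (hk .conj) (list_cons.comp hconj ht) <|
    ite (hk .disj) (list_cons.comp (list_append.comp h₁ h₂) ht) <|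
    list_cons.comp (list_map hdia (fst.comp snd).to₂) (list_tail.comp hs)).of_eq fun x => by
      unfold evalConnective
      congr!

theorem primrec_evalStep :
    Primrec fun x : ModelCode P × Token P × List (List ℕ) => evalStep x.1 x.2.1 x.2.2 := by
  classical
  have hval : Primrec fun x : (ModelCode P × Token P × List (List ℕ)) × P => x.1.1.2.2 :=
    snd.comp (snd.comp (fst.comp fst))
  have heq : PrimrecRel fun (x : (ModelCode P × Token P × List (List ℕ)) × P) (e : ℕ × P) =>
      e.2 = x.2 := Primrec.eq.comp (snd.comp snd) (snd.comp fst)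
  have hvar := primrec_filter hval heq
  have hs : Primrec fun x : ModelCode P × Token P × List (List ℕ) => x.2.2 := snd.comp snd
  refine (sumCasesOn (fst.comp snd)
    (primrec_evalConnective.comp (pair (pair (fst.comp fst) (hs.comp fst)) snd)).to₂
    (list_cons.comp (list_map hvar (fst.comp snd).to₂) (hs.comp fst)).to₂).of_eq fun x => ?_
  unfold evalStep
  congr!

theorem primrecRel_accepts : PrimrecRel (Accepts (P := P)) := by
  refine primrecRel_mem.comp (const 0) (list_headI.comp ?_)
  exact list_foldr fst (const [])
    (primrec_evalStep.comp (pair (snd.comp fst) snd)).to₂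

theorem primrec_characterisation (ps : List P) : Primrec (characterisation ps) := by
  classical
  have h₂ : Primrec fun n => 2 ^ n :=
    (nat_rec₁ 1 (nat_mul.comp snd (const 2)).to₂).of_eq fun n => by
      induction n with
      | zero => rfl
      | succ n ih => rw [pow_succ, ← ih]
  have hc : Primrec fun l : List (Token P) => modelCodes ps (2 ^ l.length) :=
    (primrec_modelCodes ps).comp (h₂.comp list_length)
  exact pair (primrec_filter hc primrecRel_accepts) (primrec_filter hc primrecRel_accepts.not)

theorem hasComputableCharacterisations_diaFragment [Finite P] {F : Set Frame.{u}}
    (hF : finFrames ⊆ F) : HasComputableCharacterisations F (diaFragment P) := by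
  obtain ⟨ps, -, hps⟩ := Finite.exists_univ_list P
  -- The list `ps` of variables is a constant of the algorithm, so its nonconstructive choice is
  -- harmless.
  refine ⟨characterisation ps, (primrec_characterisation ps).to_comp, fun φ => ⟨fun c _ => ?_,
    isFiniteCharacterisation_characterisation hps hF φ⟩⟩
  exact hF (inferInstanceAs (Finite (ULift.{u} (Fin (c.1 + 1)))))

end Computability

theorem admitsFiniteCharacterisations_diaFragment {P : Type v} [Finite P] {F : Set Frame.{u}}
    (hF : finFrames ⊆ F) : (modalClass F (diaFragment P)).AdmitsFiniteCharacterisations := by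
  obtain ⟨ps, -, hps⟩ := Finite.exists_univ_list P
  exact fun φ => ⟨_, _, isFiniteCharacterisation_characterisation hps hF φ⟩

end ModalChar

/-- The statement is made both for the class of finite frames (all examples are finite) and for the
class of all frames. `Primcodable P` is a choice of codes for the finitely many variables. -/
theorem theorem3p5 (P : Type v) [Finite P] :
    ((modalClass finFrames.{u} (diaFragment P)).AdmitsFiniteCharacterisations ∧
      (modalClass allFrames.{u} (diaFragment P)).AdmitsFiniteCharacterisations) ∧
    ∀ [Primcodable P],
      HasComputableCharacterisations finFrames.{u} (diaFragment P) ∧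
      HasComputableCharacterisations allFrames.{u} (diaFragment P) :=
  ⟨⟨admitsFiniteCharacterisations_diaFragment subset_rfl,
      admitsFiniteCharacterisations_diaFragment (Set.subset_univ _)⟩,
    fun {_} => ⟨hasComputableCharacterisations_diaFragment subset_rfl,
      hasComputableCharacterisations_diaFragment (Set.subset_univ _)⟩⟩
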